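/- Let $L$ be a first-order language and let $M$ be an $L$-structure that is $\kappa$-saturated for some uncountable cardinal $\kappa$ (for instance, a monster model of a complete theory). Let $\varphi(\bar x;\bar y)$ be a partitioned $L$-formula with $|\bar x|=m$, $|\bar y|=n$, and let $\varphi^*(\bar y;\bar x)=\varphi(\bar x;\bar y)$ be its dual formula. For a set system $\mathcal C\subseteq 2^X$ and $A\subseteq X$ put $\mathcal C(A)=\{c\cap A: c\in\mathcal C\}$; the VC dimension of $\mathcal C$ is $\sup\{|A|: A\subseteq X,\ \mathcal C(A)=2^A\}$. For $d\in\omega$, $\mathcal C$ is called $d$-maximum if it has VC dimension $d$ and $|\mathcal C(A)|=\Phi_d(|A|)$ for every finite $A\subseteq X$, where $\Phi_d(k)=\sum_{i=0}^{d}\binom{k}{i}$ if $k\ge d$ and $\Phi_d(k)=2^k$ otherwise. For a partitioned formula $\theta(\bar u;\bar v)$, $A\subseteq M^{|\bar u|}$ and $B\subseteq M^{|\bar v|}$ let $\mathcal C_\theta(A)^B=\{\theta(A;\bar b):\bar b\in B\}\subseteq 2^A$, where $\theta(A;\bar b)=\{\bar a\in A: M\models\theta(\bar a;\bar b)\}$.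 Let $\max(\theta)$ be the greatest $d\in\omega$, if it exists, such that $\mathcal C_\theta(A)^B$ is $d$-maximum for some infinite $A\subseteq M^{|\bar u|}$ and some $B\subseteq M^{|\bar v|}$; if there is no greatest such $d$, put $\max(\theta)=\infty$. Theorem. If $\max(\varphi^*)=1$, then $\varphi$ has uniform definability of types over finite sets (UDTFS): there are $k\in\omega$ and an $L$-formula $\psi(\bar y;\bar z_0,\dots,\bar z_{k-1})$ without parameters, with $|\bar z_i|=|\bar y|$, such that for every finite $B\subseteq M^{n}$ with $|B|\ge 2$ and every $\bar a\in M^{m}$ there are $\bar c_0,\dots,\bar c_{k-1}\in B$ such that for all $\bar b\in B$, $$M\models\varphi(\bar a;\bar b)\iff M\models\psi(\bar b;\bar c_0,\dots,\bar c_{k-1}).$$ -/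

import Mathlib

open FirstOrder

namespace MaxFormula

noncomputable section

/-! ### Set systems and maximum VC classes -/

/-- The trace `C(A) = {c ∩ A : c ∈ C}` of a set system on a set. -/
def trace {α : Type*} (C : Set (Set α)) (A : Set α) : Set (Set α) :=
  {s | ∃ c ∈ C, s = c ∩ A}

/-- `C` shatters `A` when `C(A)` is the full power set of `A`. -/
def Shatters {α : Type*} (C : Set (Set α)) (A : Set α) : Prop :=
  trace C A = 𝒫 A

/-- The VC dimension of a set system `C` on the set `X`: the supremum of the cardinalities
of the subsets of `X` shattered by `C`. -/
def vcDim {α : Type*} (X : Set α) (C : Set (Set α)) : ℕ∞ :=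
  ⨆ A ∈ {A : Set α | A ⊆ X ∧ Shatters C A}, A.encard

/-- Sauer's bound `Φ_d(n)`. -/
def sauerBound (d n : ℕ) : ℕ :=
  if d ≤ n then ∑ i ∈ Finset.range (d + 1), n.choose i else 2 ^ n

/-- `C` is a maximum VC class of VC dimension `d` on the set `X`. -/
def IsMaximum {α : Type*} (X : Set α) (C : Set (Set α)) (d : ℕ) : Prop :=
  vcDim X C = d ∧
    ∀ A : Finset α, (A : Set α) ⊆ X → (trace C A).ncard = sauerBound d A.card

/-! ### Partitioned formulas

A partitioned formula `φ(x̄; ȳ)` with `|x̄| = m` and `|ȳ| = n` is an `L`-formula with free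
variables indexed by `Fin m ⊕ Fin n`. -/

/-- `M ⊨ φ(a; b)`. -/
def Holds {L : Language} {M : Type*} [L.Structure M] {m n : ℕ}
    (φ : L.Formula (Fin m ⊕ Fin n)) (a : Fin m → M) (b : Fin n → M) : Prop :=
  φ.Realize (Sum.elim a b)

/-- The dual formula `φ*(ȳ; x̄) = φ(x̄; ȳ)`. -/
def dual {L : Language} {m n : ℕ} (φ : L.Formula (Fin m ⊕ Fin n)) :
    L.Formula (Fin n ⊕ Fin m) :=
  φ.relabel Sum.swap

/-- The set system `C_φ(A)^B = {φ(A; b) : b ∈ B}` on `A`, where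
`φ(A; b) = {a ∈ A : M ⊨ φ(a; b)}`. -/
def family {L : Language} {M : Type*} [L.Structure M] {m n : ℕ}
    (φ : L.Formula (Fin m ⊕ Fin n)) (A : Set (Fin m → M)) (B : Set (Fin n → M)) :
    Set (Set (Fin m → M)) :=
  {s | ∃ b ∈ B, s = {a | a ∈ A ∧ Holds φ a b}}

/-- The set of all `d` such that `C_φ(A)^B` is `d`-maximum for some infinite
`A ⊆ M^{|x̄|}` and some `B ⊆ M^{|ȳ|}`. -/
def maximumDims {L : Language} (M : Type*) [L.Structure M] {m n : ℕ}
    (φ : L.Formula (Fin m ⊕ Fin n)) : Set ℕ :=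
  {d | ∃ (A : Set (Fin m → M)) (B : Set (Fin n → M)),
    A.Infinite ∧ IsMaximum A (family φ A B) d}

open Classical in
/-- `max(φ)`: the greatest element of `maximumDims M φ` if there is one, and `∞` otherwise. -/
def maxDim {L : Language} (M : Type*) [L.Structure M] {m n : ℕ}
    (φ : L.Formula (Fin m ⊕ Fin n)) : ℕ∞ :=
  if h : ∃ d, IsGreatest (maximumDims M φ) d then (h.choose : ℕ∞) else ⊤

/-- Uniform definability of types over finite sets. There are `k` and a single `L`-formula
`ψ(ȳ; z̄₀, …, z̄ₖ₋₁)` without parameters, `|z̄ᵢ| = |ȳ|`, such that for every finite set `B` of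
`ȳ`-tuples with at least two elements, every complete `φ`-type over `B` (that is, the `φ`-type
`{φ(x̄; b) : b ∈ B, M ⊨ φ(a; b)} ∪ {¬φ(x̄; b) : b ∈ B, M ⊭ φ(a; b)}` of some tuple `a`) is
defined on `B` by `ψ(ȳ; c₀, …, cₖ₋₁)` for some `c₀, …, cₖ₋₁ ∈ B`. -/
def HasUDTFS {L : Language} (M : Type*) [L.Structure M] {m n : ℕ}
    (φ : L.Formula (Fin m ⊕ Fin n)) : Prop :=
  ∃ (k : ℕ) (ψ : L.Formula (Fin n ⊕ (Fin k × Fin n))),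
    ∀ B : Finset (Fin n → M), 2 ≤ B.card → ∀ a : Fin m → M,
      ∃ c : Fin k → (Fin n → M), (∀ i, c i ∈ B) ∧
        ∀ b ∈ B, (Holds φ a b ↔ ψ.Realize (Sum.elim b (fun p => c p.1 p.2)))

/-- `M` is `κ`-saturated: for every `A ⊆ M` with `|A| < κ`, every set of formulas in finitely
many variables with parameters from `A` that is finitely satisfiable in `M` is realized
in `M`. -/
def IsSaturated (L : Language) (M : Type*) [L.Structure M] (κ : Cardinal) : Prop :=
  ∀ A : Set M, Cardinal.mk A < κ → ∀ (n : ℕ) (p : Set (L[[A]].Formula (Fin n))),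
    (∀ q : Finset (L[[A]].Formula (Fin n)), (q : Set (L[[A]].Formula (Fin n))) ⊆ p →
      ∃ v : Fin n → M, ∀ θ ∈ q, θ.Realize v) →
    ∃ v : Fin n → M, ∀ θ ∈ p, θ.Realize v

end

end MaxFormula

namespace MaxFormula

/-! ### Shattering for relations -/

/-! Only the absence of 2-maximum families for the dual formula is used. If `φ` shattered
arbitrarily long sequences, saturation over countable parameter sets would give an infinite sequence
on which every subset is cut out by some tuple. Keeping the tuples that cut out at most two points
would then yield a 2-maximum family on an infinite set. Hence `φ` is dependent
(`exists_not_shattersSeq`).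

Dependence gives UDTFS by a sample compression argument. On a finite `B`, every φ-type is a majority
vote of boundedly many φ-types, each determined by its restriction to boundedly many points of `B`
(`exists_majority`). This combines uniform approximation by small samples (`exists_approx`), members
with short teaching sequences (`exists_teaching`) and boosting, followed by sampling the votes
through the dual family. Such a vote is first-order: each voter is described by the points that
determine it and by truth values there, coded by equality of two tuples from `B`
(`hasUDTFS_of_not_shattersSeq`). -/

/-- The sets `{ω | R c ω}` shatter some sequence of `d` points. -/
def ShattersSeq {ι Ω : Type*} (R : ι → Ω → Prop) (d : ℕ) : Prop :=
  ∃ x : Fin d → Ω, ∀ η : Fin d → Prop, ∃ c, ∀ i, R c (x i) ↔ η i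

theorem ShattersSeq.comap {ι Ω ι' Ω' : Type*} {R : ι → Ω → Prop} (g : ι' → ι) (f : Ω' → Ω) {d : ℕ}
    (h : ShattersSeq (fun c x => R (g c) (f x)) d) : ShattersSeq R d := by
  obtain ⟨x, hx⟩ := h
  refine ⟨f ∘ x, fun η => ?_⟩
  obtain ⟨c, hc⟩ := hx η
  exact ⟨g c, hc⟩

/-- Twisting by `p` permutes the patterns on any sequence. This transfers the dimension bound to the
error sets of hypotheses relative to a fixed target. -/
theorem ShattersSeq.symmDiff {ι Ω : Type*} {R : ι → Ω → Prop} (p : Ω → Prop) {d : ℕ}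
    (h : ShattersSeq (fun c x => R c x ↔ p x) d) : ShattersSeq R d := by
  obtain ⟨x, hx⟩ := h
  refine ⟨x, fun η => ?_⟩
  obtain ⟨c, hc⟩ := hx (fun i => η i ↔ p (x i))
  refine ⟨c, fun i => ?_⟩
  have := hc i
  tauto

/-- Index the `2 ^ d` shattered members by the patterns of length `d`; the point that selects
exactly the patterns true at coordinate `i` serves as the `i`-th point of the shattered sequence. -/
theorem ShattersSeq.of_flip {ι Ω : Type*} {R : ι → Ω → Prop} {d : ℕ}
    (h : ShattersSeq (fun x c => R c x) (Fintype.card (Fin d → Prop))) : ShattersSeq R d := by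
  obtain ⟨c, hc⟩ := h
  let e := Fintype.equivFin (Fin d → Prop)
  choose x hx using hc
  refine ⟨fun i => x (fun j => e.symm j i), fun η => ⟨c (e η), fun i => ?_⟩⟩
  have := hx (fun j => e.symm j i) (e η)
  simpa using this

open Classical in
/-- Sauer–Shelah bound on the number of traces on a finite set. -/
theorem card_traces_le {ι Ω X : Type*} [Fintype X] {R : ι → Ω → Prop} {d : ℕ}
    (hR : ¬ ShattersSeq R d) (f : X → Ω) :
    (Finset.univ.filter (fun S : Finset X => ∃ c, ∀ x, x ∈ S ↔ R c (f x))).card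
      ≤ d * (Fintype.card X + 1) ^ d := by
  set 𝒜 := Finset.univ.filter (fun S : Finset X => ∃ c, ∀ x, x ∈ S ↔ R c (f x)) with h𝒜
  have hd : ∀ t, 𝒜.Shatters t → t.card < d := by
    intro t ht
    by_contra hlt
    push Not at hlt
    obtain ⟨t', ht't, ht'⟩ := Finset.exists_subset_card_eq hlt
    have hs := ht.mono_right ht't
    apply hR
    let e := t'.equivFinOfCardEq ht'
    refine ⟨fun i => f (e.symm i), fun η => ?_⟩
    obtain ⟨u, hu, hut⟩ := hs (t := t'.filter (fun a => ∃ h : a ∈ t', η (e ⟨a, h⟩)))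
      (Finset.filter_subset _ _)
    obtain ⟨c, hc⟩ := (Finset.mem_filter.1 hu).2
    refine ⟨c, fun i => ?_⟩
    rw [← hc]
    have h2 : ((e.symm i : X) ∈ t' ∩ u) ↔ η i := by
      rw [hut, Finset.mem_filter]
      simp
    simpa using h2
  -- An empty shatterer has supremum 0, so `k < d` can fail there when `d = 0`.
  have hv : ∀ k ∈ Finset.Iic 𝒜.vcDim, k < d ∨ 𝒜.shatterer = ∅ := by
    intro k hk
    by_cases he : 𝒜.shatterer = ∅
    · exact Or.inr he
    · obtain ⟨t, ht, hte⟩ := Finset.exists_mem_eq_sup _ (Finset.nonempty_iff_ne_empty.2 he)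
        (Finset.card : Finset X → ℕ)
      left
      have := hd t (Finset.mem_shatterer.1 ht)
      rw [Finset.mem_Iic, Finset.vcDim, hte] at hk
      omega
  refine (Finset.card_le_card_shatterer 𝒜).trans ?_
  by_cases he : 𝒜.shatterer = ∅
  · simp [he]
  refine (Finset.card_shatterer_le_sum_vcDim).trans ?_
  calc ∑ k ∈ Finset.Iic 𝒜.vcDim, (Fintype.card X).choose k
      ≤ ∑ k ∈ Finset.range d, (Fintype.card X).choose k := by
        refine Finset.sum_le_sum_of_subset fun k hk => ?_
        rcases hv k hk with h | h
        · exact Finset.mem_range.2 h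
        · exact absurd h he
    _ ≤ ∑ k ∈ Finset.range d, (Fintype.card X + 1) ^ d := by
        refine Finset.sum_le_sum fun k hk => ?_
        refine (Nat.choose_le_pow _ _).trans ?_
        exact (Nat.pow_le_pow_left (Nat.le_succ _) k).trans
          (Nat.pow_le_pow_right (Nat.succ_pos _) (Finset.mem_range.1 hk).le)
    _ = _ := by simp

/-! ### Approximation by samples of bounded size -/

/-- Swap the components of the pairs `p i` for which `σ i` holds. -/
def swapAt {I α : Type*} (σ : I → Bool) (p : I → α × α) : I → α × α :=
  fun i => if σ i then (p i).swap else p i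

theorem swapAt_involutive {I α : Type*} (σ : I → Bool) :
    Function.Involutive (swapAt σ : (I → α × α) → (I → α × α)) := by
  intro p
  funext i
  by_cases h : σ i <;> simp [swapAt, h]

/-- Difference of the indicators of a pair of truth values. -/
def boolDiff (q : Bool × Bool) : ℝ := (if q.1 then 1 else 0) - (if q.2 then 1 else 0)

theorem boolDiff_swapAt {I : Type*} (σ : I → Bool) (τ : I → Bool × Bool) (i : I) :
    boolDiff (swapAt σ τ i) = (if σ i then -1 else 1) * boolDiff (τ i) := by
  by_cases h : σ i <;> simp [swapAt, h, boolDiff]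

theorem abs_boolDiff_le (q : Bool × Bool) : |boolDiff q| ≤ 1 := by
  rcases q with ⟨a, b⟩
  cases a <;> cases b <;> simp [boolDiff]

/-- The signs are independent, so the sum factors into terms `2 cosh(lam δᵢ)` with `|δᵢ| ≤ 1`, each
at most `2 exp(lam² / 2)`: Hoeffding's bound for random signs. -/
theorem sum_exp_signs_le {m : ℕ} (lam : ℝ) (τ : Fin m → Bool × Bool) :
    ∑ σ : Fin m → Bool, Real.exp (lam * ∑ i, boolDiff (swapAt σ τ i))
      ≤ 2 ^ m * Real.exp (lam ^ 2 / 2 * m) := by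
  have h1 : ∀ σ : Fin m → Bool, Real.exp (lam * ∑ i, boolDiff (swapAt σ τ i))
      = ∏ i, (fun (i : Fin m) (s : Bool) =>
          Real.exp (lam * ((if s then -1 else 1) * boolDiff (τ i)))) i (σ i) := by
    intro σ
    rw [Finset.mul_sum, Real.exp_sum]
    simp only [boolDiff_swapAt]
  rw [Finset.sum_congr rfl fun σ _ => h1 σ, ← Fintype.prod_sum (fun (i : Fin m) (s : Bool) =>
    Real.exp (lam * ((if s then -1 else 1) * boolDiff (τ i))))]
  calc _ ≤ ∏ i : Fin m, (2 * Real.exp (lam ^ 2 / 2)) := by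
        refine Finset.prod_le_prod (fun i _ => Finset.sum_nonneg fun _ _ => (Real.exp_pos _).le)
          fun i _ => ?_
        have h2 := Real.cosh_le_exp_half_sq (lam * boolDiff (τ i))
        have h3 : (lam * boolDiff (τ i)) ^ 2 / 2 ≤ lam ^ 2 / 2 := by
          have := abs_boolDiff_le (τ i)
          have h4 : boolDiff (τ i) ^ 2 ≤ 1 := by
            rw [← sq_abs]; exact pow_le_one₀ (abs_nonneg _) this
          rw [mul_pow]
          nlinarith [sq_nonneg lam]
        have h5 := h2.trans (Real.exp_le_exp.2 h3)
        rw [Real.cosh_eq] at h5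
        simp only [Fintype.sum_bool, if_true, Bool.false_eq_true, if_false, one_mul, neg_mul,
          mul_neg]
        linarith
    _ = _ := by
        rw [Finset.prod_const, Finset.card_univ, Fintype.card_fin, mul_pow, ← Real.exp_nat_mul]
        ring_nf

open Classical in
/-- The pair pattern `τ` is cut out of the pairs `p` by some set of the family. -/
def Realizes {I ι Ω : Type*} (R : ι → Ω → Prop) (p : I → Ω × Ω) (τ : I → Bool × Bool) : Prop :=
  ∃ c, ∀ i, τ i = (decide (R c (p i).1), decide (R c (p i).2))

theorem realizes_swapAt {I ι Ω : Type*} {R : ι → Ω → Prop} (σ : I → Bool) {p : I → Ω × Ω}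
    {τ : I → Bool × Bool} : Realizes R (swapAt σ p) (swapAt σ τ) ↔ Realizes R p τ := by
  refine exists_congr fun c => forall_congr' fun i => ?_
  by_cases h : σ i
  · have hp : swapAt σ p i = (p i).swap := by simp [swapAt, h]
    have hτ : swapAt σ τ i = (τ i).swap := by simp [swapAt, h]
    rw [hp, hτ]
    simp [Prod.ext_iff, and_comm]
  · have hp : swapAt σ p i = p i := by simp [swapAt, h]
    have hτ : swapAt σ τ i = τ i := by simp [swapAt, h]
    rw [hp, hτ]

open Classical in
theorem card_realizes_le {ι Ω : Type*} {R : ι → Ω → Prop} {d m : ℕ}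
    (hR : ¬ ShattersSeq R d) (p : Fin m → Ω × Ω) :
    (Finset.univ.filter (fun τ : Fin m → Bool × Bool => Realizes R p τ)).card
      ≤ d * (2 * m + 1) ^ d := by
  have h := card_traces_le hR (Sum.elim (fun i => (p i).1) (fun i => (p i).2))
  rw [Fintype.card_sum, Fintype.card_fin, ← two_mul] at h
  refine le_trans ?_ h
  refine Finset.card_le_card_of_injOn
    (fun τ => Finset.univ.filter
      (fun x => (Sum.elim (fun i => (τ i).1) (fun i => (τ i).2) x : Bool) = true)) ?_ ?_
  · intro τ hτ
    obtain ⟨c, hc⟩ := (Finset.mem_filter.1 hτ).2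
    refine Finset.mem_coe.2 (Finset.mem_filter.2 ⟨Finset.mem_univ _, c, ?_⟩)
    rintro (i | i) <;> simp [hc i]
  · intro τ _ τ' _ hh
    funext i
    have h1 := Finset.ext_iff.1 hh (Sum.inl i)
    have h2 := Finset.ext_iff.1 hh (Sum.inr i)
    simp only [Finset.mem_filter, Finset.mem_univ, true_and, Sum.elim_inl, Sum.elim_inr] at h1 h2
    exact Prod.ext (Bool.eq_iff_iff.2 h1) (Bool.eq_iff_iff.2 h2)

-- Symmetrization: swapping within pairs permutes the pairs and the patterns compatibly with
-- `Realizes`, so the sum equals its average over all `σ`. For a fixed pattern that average obeys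
-- the sign bound, and only polynomially many patterns are realized.
open Classical in
theorem sum_realizes_exp_le {ι Ω : Type*} [Fintype Ω] {R : ι → Ω → Prop} {d m : ℕ}
    (hR : ¬ ShattersSeq R d) (lam : ℝ) :
    ∑ p : Fin m → Ω × Ω, ∑ τ : Fin m → Bool × Bool,
      (if Realizes R p τ then Real.exp (lam * ∑ i, boolDiff (τ i)) else 0)
      ≤ (Fintype.card (Fin m → Ω × Ω)) * (d * (2 * m + 1) ^ d * Real.exp (lam ^ 2 / 2 * m)) := by
  set F : ℝ := ∑ p : Fin m → Ω × Ω, ∑ τ : Fin m → Bool × Bool,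
      (if Realizes R p τ then Real.exp (lam * ∑ i, boolDiff (τ i)) else 0) with hF
  have h1 : ∀ σ : Fin m → Bool, F = ∑ p : Fin m → Ω × Ω, ∑ τ : Fin m → Bool × Bool,
      (if Realizes R p τ then Real.exp (lam * ∑ i, boolDiff (swapAt σ τ i)) else 0) := by
    intro σ
    rw [hF, ← Equiv.sum_comp (swapAt_involutive σ).toPerm]
    refine Finset.sum_congr rfl fun p _ => ?_
    rw [← Equiv.sum_comp (swapAt_involutive σ).toPerm]
    refine Finset.sum_congr rfl fun τ _ => ?_
    simp only [Function.Involutive.coe_toPerm, realizes_swapAt]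
  have h2 : (2 : ℝ) ^ m * F = ∑ p : Fin m → Ω × Ω, ∑ τ : Fin m → Bool × Bool,
      (if Realizes R p τ then
        ∑ σ : Fin m → Bool, Real.exp (lam * ∑ i, boolDiff (swapAt σ τ i)) else 0) := by
    have : (2 : ℝ) ^ m * F = ∑ _σ : Fin m → Bool, F := by simp
    rw [this, Finset.sum_congr rfl fun σ _ => h1 σ, Finset.sum_comm]
    refine Finset.sum_congr rfl fun p _ => ?_
    rw [Finset.sum_comm]
    refine Finset.sum_congr rfl fun τ _ => ?_
    split_ifs <;> simp
  have h3 : (2 : ℝ) ^ m * F ≤ 2 ^ m * ((Fintype.card (Fin m → Ω × Ω)) *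
      (d * (2 * m + 1) ^ d * Real.exp (lam ^ 2 / 2 * m))) := by
    rw [h2]
    calc _ ≤ ∑ p : Fin m → Ω × Ω,
          ((d * (2 * m + 1) ^ d : ℕ) : ℝ) * (2 ^ m * Real.exp (lam ^ 2 / 2 * m)) := by
          refine Finset.sum_le_sum fun p _ => ?_
          rw [← Finset.sum_filter]
          refine (Finset.sum_le_card_nsmul _ _ _ fun τ _ => sum_exp_signs_le lam τ).trans ?_
          rw [nsmul_eq_mul]
          gcongr
          exact_mod_cast card_realizes_le hR p
      _ = _ := by
          rw [Finset.sum_const, nsmul_eq_mul, Finset.card_univ]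
          push_cast
          ring
  exact le_of_mul_le_mul_left h3 (by positivity)

theorem exists_pow_lt_exp (d : ℕ) {ε : ℝ} (hε : 0 < ε) :
    ∃ m : ℕ, 0 < m ∧ 2 * ((d : ℝ) * (2 * m + 1) ^ d) < Real.exp (ε ^ 2 / 2 * m) := by
  have h1 : (fun x : ℝ => x ^ d) =o[Filter.atTop] fun x => Real.exp (ε ^ 2 / 2 * x) :=
    isLittleO_pow_exp_pos_mul_atTop d (by positivity)
  -- The constant absorbs `2 * m + 1 ≤ 3 * m`; `d + 1` in place of `d` keeps it positive and makes
  -- the final inequality strict.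
  have h2 := (h1.comp_tendsto tendsto_natCast_atTop_atTop).def
    (c := 1 / (2 * (d + 1) * 3 ^ d)) (by positivity)
  obtain ⟨m, hm, hm0⟩ := (h2.and (Filter.eventually_gt_atTop 0)).exists
  refine ⟨m, hm0, ?_⟩
  simp only [Function.comp_apply, Real.norm_eq_abs, Real.abs_exp] at hm
  rw [abs_of_nonneg (by positivity), div_mul_eq_mul_div, le_div_iff₀ (by positivity), one_mul] at hm
  have hm1 : (1 : ℝ) ≤ m := by exact_mod_cast hm0
  have h4 : (2 * m + 1 : ℝ) ^ d ≤ (3 * m) ^ d := by gcongr; linarith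
  have h5 : (0 : ℝ) < (m : ℝ) ^ d * 3 ^ d := by positivity
  rw [mul_pow] at h4
  have h6 : (d : ℝ) * (2 * m + 1 : ℝ) ^ d ≤ d * (3 ^ d * m ^ d) := by gcongr
  nlinarith

open Classical in
/-- Uniform approximation: in the absence of shattered sequences of length `d`, on every finite
probability space with the uniform measure some sample of bounded size approximates the measure
of all sets of the family. -/
theorem exists_approx (d : ℕ) {ε : ℝ} (hε : 0 < ε) :
    ∃ m : ℕ, 0 < m ∧ ∀ {ι Ω : Type*} [Fintype Ω] [Nonempty Ω] (R : ι → Ω → Prop),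
      ¬ ShattersSeq R d → ∃ s : Fin m → Ω, ∀ c,
        |((Finset.univ.filter fun i => R c (s i)).card : ℝ) / m
          - ((Finset.univ.filter fun ω => R c ω).card : ℝ) / Fintype.card Ω| ≤ ε := by
  obtain ⟨m, hm0, hm⟩ := exists_pow_lt_exp d hε
  refine ⟨m, hm0, ?_⟩
  intro ι Ω _ _ R hR
  by_contra hcon
  push Not at hcon
  choose c hc using hcon
  have hmR : (0 : ℝ) < m := by exact_mod_cast hm0
  set N : ℝ := ((Fintype.card (Fin m → Ω) : ℕ) : ℝ) with hN
  have hN0 : 0 < N := by rw [hN]; exact_mod_cast Fintype.card_pos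
  have hΩ0 : (0 : ℝ) < Fintype.card Ω := by exact_mod_cast Fintype.card_pos
  -- Compare the sample `s` with an independent ghost sample `s'` on the set that `s` approximates
  -- badly. The mean over `s'` is `m` times the deviation.
  let D : (Fin m → Ω) → (Fin m → Ω) → ℝ := fun s s' =>
    ∑ i, boolDiff (decide (R (c s) (s i)), decide (R (c s) (s' i)))
  have havg : ∀ s, ∑ s', N⁻¹ * D s s' = m *
      (((Finset.univ.filter fun i => R (c s) (s i)).card : ℝ) / m
          - ((Finset.univ.filter fun ω => R (c s) ω).card : ℝ) / Fintype.card Ω) := by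
    intro s
    have hD : ∀ s', D s s' = ((Finset.univ.filter fun i => R (c s) (s i)).card : ℝ)
        - ∑ i, (if R (c s) (s' i) then 1 else 0) := by
      intro s'
      simp [D, boolDiff, Finset.sum_sub_distrib]
    have hm1 : ∀ i : Fin m, ∑ s' : Fin m → Ω, (if R (c s) (s' i) then (1 : ℝ) else 0)
        = N / Fintype.card Ω * ((Finset.univ.filter fun ω => R (c s) ω).card : ℝ) := by
      intro i
      have := Fintype.sum_piFinset_apply (fun ω => if R (c s) ω then (1 : ℝ) else 0)
        (Finset.univ : Finset Ω) i
      rw [Fintype.piFinset_univ] at this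
      rw [this, hN, Fintype.card_pi_const, Fintype.card_fin, Finset.card_univ]
      obtain ⟨k, rfl⟩ := Nat.exists_eq_succ_of_ne_zero hm0.ne'
      simp only [Nat.succ_eq_add_one, Nat.add_sub_cancel, nsmul_eq_mul, Finset.sum_boole,
        Nat.cast_pow, Nat.cast_mul, pow_succ]
      field_simp
    rw [← Finset.mul_sum, Finset.sum_congr rfl fun s' _ => hD s', Finset.sum_sub_distrib,
      Finset.sum_comm, Finset.sum_congr rfl fun i _ => hm1 i, Finset.sum_const, Finset.sum_const,
      Finset.card_univ, Finset.card_univ, Fintype.card_fin, nsmul_eq_mul, nsmul_eq_mul, ← hN]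
    field_simp
  -- Jensen's inequality; adding both signs of the exponent covers either direction of the
  -- deviation.
  have hJ : ∀ s, Real.exp (ε * (ε * m)) ≤
      ∑ s', N⁻¹ * (Real.exp (ε * D s s') + Real.exp (-ε * D s s')) := by
    intro s
    have hw : ∑ _s' : Fin m → Ω, N⁻¹ = 1 := by
      rw [Finset.sum_const, Finset.card_univ, nsmul_eq_mul, ← hN, mul_inv_cancel₀ hN0.ne']
    have hJ1 : ∀ a : ℝ, Real.exp (a * ∑ s', N⁻¹ * D s s') ≤ ∑ s', N⁻¹ * Real.exp (a * D s s') := by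
      intro a
      have := convexOn_exp.map_sum_le (t := Finset.univ) (w := fun _ : Fin m → Ω => N⁻¹)
        (p := fun s' => a * D s s') (fun _ _ => by positivity) hw (fun _ _ => Set.mem_univ _)
      simp only [smul_eq_mul] at this
      refine le_trans (le_of_eq ?_) this
      rw [Finset.mul_sum]
      congr 1
      exact Finset.sum_congr rfl fun _ _ => by ring
    have hle : ∀ a : ℝ, (a = ε ∨ a = -ε) → ∑ s', N⁻¹ * Real.exp (a * D s s') ≤
        ∑ s', N⁻¹ * (Real.exp (ε * D s s') + Real.exp (-ε * D s s')) := by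
      intro a ha
      refine Finset.sum_le_sum fun s' _ => mul_le_mul_of_nonneg_left ?_ (by positivity)
      rcases ha with rfl | rfl
      · linarith [Real.exp_pos (-a * D s s')]
      · linarith [Real.exp_pos (ε * D s s')]
    rcases lt_abs.1 (hc s) with h | h
    · refine (Real.exp_le_exp.2 ?_).trans ((hJ1 ε).trans (hle ε (Or.inl rfl)))
      rw [havg s, mul_comm (m : ℝ)]
      gcongr
    · refine (Real.exp_le_exp.2 ?_).trans ((hJ1 (-ε)).trans (hle (-ε) (Or.inr rfl)))
      rw [havg s, mul_comm (m : ℝ), neg_mul, ← mul_neg, ← neg_mul]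
      gcongr
  -- Summing over all realized patterns removes the dependence of the bad member `c s` on the
  -- sample, so that symmetrization applies.
  have hbound : ∀ s s', Real.exp (ε * D s s') + Real.exp (-ε * D s s') ≤
      ∑ τ : Fin m → Bool × Bool,
      ((if Realizes R (fun i => (s i, s' i)) τ then Real.exp (ε * ∑ i, boolDiff (τ i)) else 0) +
      (if Realizes R (fun i => (s i, s' i)) τ then Real.exp (-ε * ∑ i, boolDiff (τ i)) else 0)) := by
    intro s s'
    have hr : Realizes R (fun i => (s i, s' i))
      (fun i => (decide (R (c s) (s i)), decide (R (c s) (s' i)))) := ⟨c s, fun i => rfl⟩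
    refine le_trans (le_of_eq ?_) (Finset.single_le_sum (fun τ _ => ?_) (Finset.mem_univ
      (fun i => (decide (R (c s) (s i)), decide (R (c s) (s' i))))))
    · rw [if_pos hr, if_pos hr]
    · split_ifs <;> positivity
  have hcard : ((Fintype.card (Fin m → Ω × Ω) : ℕ) : ℝ) = N * N := by
    rw [hN]
    simp [mul_pow]
  have hsum : N * Real.exp (ε * (ε * m)) ≤
      N⁻¹ * ((N * N) * (2 * (d * (2 * m + 1) ^ d) * Real.exp (ε ^ 2 / 2 * m))) := by
    have e1 := sum_realizes_exp_le (m := m) hR ε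
    have e2 := sum_realizes_exp_le (m := m) hR (-ε)
    rw [hcard] at e1 e2
    rw [neg_sq] at e2
    calc N * Real.exp (ε * (ε * m)) = ∑ _s : Fin m → Ω, Real.exp (ε * (ε * m)) := by
          rw [Finset.sum_const, Finset.card_univ, nsmul_eq_mul]
      _ ≤ ∑ s, ∑ s', N⁻¹ * (Real.exp (ε * D s s') + Real.exp (-ε * D s s')) :=
          Finset.sum_le_sum fun s _ => hJ s
      _ = N⁻¹ * ∑ s, ∑ s', (Real.exp (ε * D s s') + Real.exp (-ε * D s s')) := by
          simp only [Finset.mul_sum]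
      _ ≤ N⁻¹ * ∑ s : Fin m → Ω, ∑ s' : Fin m → Ω, ∑ τ : Fin m → Bool × Bool,
          ((if Realizes R (fun i => (s i, s' i)) τ then
              Real.exp (ε * ∑ i, boolDiff (τ i)) else 0) +
          (if Realizes R (fun i => (s i, s' i)) τ then
              Real.exp (-ε * ∑ i, boolDiff (τ i)) else 0)) := by
          gcongr with s _ s' _
          exact hbound s s'
      _ = N⁻¹ * ∑ p : Fin m → Ω × Ω, ∑ τ : Fin m → Bool × Bool,
          ((if Realizes R p τ then Real.exp (ε * ∑ i, boolDiff (τ i)) else 0) +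
          (if Realizes R p τ then Real.exp (-ε * ∑ i, boolDiff (τ i)) else 0)) := by
          rw [← Fintype.sum_prod_type',
            ← Equiv.sum_comp (Equiv.arrowProdEquivProdArrow (Fin m) (fun _ => Ω) (fun _ => Ω))]
          rfl
      _ ≤ _ := by
          gcongr
          simp only [Finset.sum_add_distrib]
          linarith
  have h1 : N⁻¹ * ((N * N) * (2 * (d * (2 * m + 1) ^ d) * Real.exp (ε ^ 2 / 2 * m)))
      = N * (2 * (d * (2 * m + 1) ^ d) * Real.exp (ε ^ 2 / 2 * m)) := by
    field_simp
  rw [h1] at hsum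
  have h2 := le_of_mul_le_mul_left hsum hN0
  have h3 : Real.exp (ε * (ε * m)) = Real.exp (ε ^ 2 / 2 * m) * Real.exp (ε ^ 2 / 2 * m) := by
    rw [← Real.exp_add]; ring_nf
  rw [h3] at h2
  exact absurd (le_of_mul_le_mul_right h2 (Real.exp_pos _)) (not_le.2 hm)

/-! ### Teaching sequences -/

/-- A nonempty family of subsets of a finite set which shatters no sequence of `d` points has a
member determined by its trace on a sequence of bounded length (Chen, Cheng and Tang). -/
theorem exists_teaching (d : ℕ) : ∃ k : ℕ, ∀ {ι Ω : Type*} [Finite Ω] [Nonempty Ω] [Nonempty ι]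
    (R : ι → Ω → Prop), ¬ ShattersSeq R d →
      ∃ (c : ι) (z : Fin k → Ω), ∀ c', (∀ i, R c' (z i) ↔ R c (z i)) → R c' = R c := by
  classical
  induction d with
  | zero =>
    refine ⟨0, fun {ι Ω} _ _ _ R hR => (hR ?_).elim⟩
    exact ⟨Fin.elim0, fun η => ⟨Classical.arbitrary ι, fun i => i.elim0⟩⟩
  | succ d ih =>
    rcases Nat.eq_zero_or_pos d with rfl | hd
    · refine ⟨0, fun {ι Ω} _ _ _ R hR => ?_⟩
      have hsub : ∀ i : Fin (0 + 1), i = 0 := fun i => Subsingleton.elim (α := Fin 1) i 0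
      let c := Classical.arbitrary ι
      refine ⟨c, Fin.elim0, fun c' _ => funext fun ω => ?_⟩
      by_contra hne
      refine hR ⟨fun _ => ω, fun η => ?_⟩
      by_cases h : R c ω ↔ η 0
      · exact ⟨c, fun i => by rw [hsub i]; exact h⟩
      · refine ⟨c', fun i => ?_⟩
        rw [hsub i]
        rw [eq_iff_iff] at hne
        tauto
    obtain ⟨k, hk⟩ := ih
    -- One more than `d` points for each pattern of length `d`, for the pigeonhole step that finds a
    -- point outside every `bad η`.
    set K := Fintype.card (Fin d → Prop) * d + 1 with hK
    refine ⟨K + k, fun {ι Ω} _ _ _ R hR => ?_⟩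
    let agree : (Fin K → Ω) × ι → Set ι := fun q => {c' | ∀ j, R c' (q.1 j) ↔ R q.2 (q.1 j)}
    let size : (Fin K → Ω) × ι → ℕ := fun q => (R '' agree q).ncard
    -- Choose `K` points and a member leaving as few distinct agreeing sets as possible. Minimality
    -- will force this subfamily to shatter no `d` points.
    obtain ⟨⟨Y, c⟩, hmin⟩ : ∃ q, ∀ q', size q ≤ size q' := by
      refine ⟨Function.argmin size, fun q' => Function.argmin_le size q'⟩
    have hcc : c ∈ agree (Y, c) := fun j => Iff.rfl
    have : Nonempty (agree (Y, c)) := ⟨⟨c, hcc⟩⟩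
    have hsub : ¬ ShattersSeq (fun (c' : agree (Y, c)) ω => R c' ω) d := by
      rintro ⟨x, hx⟩
      -- The points of `Y` whose value is forced, throughout the whole family, by the pattern `η` on
      -- `x`.
      let bad : (Fin d → Prop) → Finset (Fin K) := fun η => Finset.univ.filter fun j =>
        ∀ c', (∀ i, R c' (x i) ↔ η i) → (R c' (Y j) ↔ R c (Y j))
      have hbad : ∀ η, (bad η).card < d := by
        intro η
        by_contra hlt
        push Not at hlt
        obtain ⟨W, hWb, hWd⟩ := Finset.exists_subset_card_eq hlt
        let e : Fin d ↪ Fin K := (W.equivFinOfCardEq hWd).symm.toEmbedding.trans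
          (Function.Embedding.subtype _)
        have he : ∀ i, e i ∈ bad η := fun i => hWb ((W.equivFinOfCardEq hWd).symm i).2
        obtain ⟨⟨c₁, hc₁⟩, hη⟩ := hx η
        simp only at hη
        -- Trade `d` forced points for `x`. Agreement with `c₁` on `Y'` still forces the old values
        -- at the discarded points, but excludes members with the opposite pattern on `x`; this
        -- contradicts minimality.
        let Y' : Fin K → Ω := Function.extend e x Y
        have hYe : ∀ i, Y' (e i) = x i := fun i => e.injective.extend_apply _ _ _
        have hpat : ∀ c' ∈ agree (Y', c₁), ∀ i, R c' (x i) ↔ η i := by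
          intro c' hc' i
          have := hc' (e i)
          simp only [hYe] at this
          rw [this, hη]
        have hss : R '' agree (Y', c₁) ⊂ R '' agree (Y, c) := by
          rw [Set.ssubset_iff_of_subset]
          · obtain ⟨⟨c₂, hc₂⟩, hη₂⟩ := hx (fun i => ¬ η i)
            refine ⟨R c₂, ⟨c₂, hc₂, rfl⟩, ?_⟩
            rintro ⟨c₃, hc₃, h₃⟩
            have h4 := hpat c₃ hc₃ ⟨0, hd⟩
            have h5 := hη₂ ⟨0, hd⟩
            rw [h₃] at h4
            simp only at h5
            tauto
          · refine Set.image_mono fun c' hc' j => ?_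
            by_cases hj : ∃ i, e i = j
            · obtain ⟨i, rfl⟩ := hj
              exact (Finset.mem_filter.1 (he i)).2 c' (hpat c' hc')
            · have h1 := hc' j
              have h2 : Y' j = Y j := Function.extend_apply' _ _ _ hj
              simp only [h2] at h1
              exact h1.trans (hc₁ j)
        exact absurd (hmin (Y', c₁)) (not_le.2 (Set.ncard_lt_ncard hss (Set.toFinite _)))
      have hunion : (Finset.univ.biUnion bad).card < K := by
        refine lt_of_le_of_lt (Finset.card_biUnion_le_card_mul _ _ d fun η _ => (hbad η).le) ?_
        rw [Finset.card_univ, hK]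
        omega
      obtain ⟨j, hj⟩ : ∃ j, j ∉ Finset.univ.biUnion bad := by
        by_contra hall
        push Not at hall
        rw [Finset.eq_univ_of_forall hall, Finset.card_univ, Fintype.card_fin] at hunion
        exact lt_irrefl _ hunion
      -- A point outside every `bad η` extends `x` to a shattered sequence: members agreeing with
      -- `c` on `Y` give one value there, failure of forcing gives the other.
      refine hR ⟨Fin.snoc (α := fun _ => Ω) x (Y j), fun η => ?_⟩
      by_cases h : R c (Y j) ↔ η (Fin.last d)
      · obtain ⟨⟨c₁, hc₁⟩, hη⟩ := hx (fun i => η i.castSucc)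
        refine ⟨c₁, fun i => ?_⟩
        refine Fin.lastCases ?_ (fun i => ?_) i
        · rw [Fin.snoc_last]; exact (hc₁ j).trans h
        · rw [Fin.snoc_castSucc]; exact hη i
      · have hj' : j ∉ bad (fun i => η i.castSucc) := fun hb =>
          hj (Finset.mem_biUnion.2 ⟨_, Finset.mem_univ _, hb⟩)
        simp only [bad, Finset.mem_filter, Finset.mem_univ, true_and, not_forall] at hj'
        obtain ⟨c', hc', hne⟩ := hj'
        refine ⟨c', fun i => ?_⟩
        refine Fin.lastCases ?_ (fun i => ?_) i
        · rw [Fin.snoc_last]; tauto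
        · rw [Fin.snoc_castSucc]; exact hc' i
    obtain ⟨⟨c₀, hc₀⟩, z, hz⟩ := hk (fun (c' : agree (Y, c)) ω => R c' ω) hsub
    refine ⟨c₀, Fin.append Y z, fun c' hc' => ?_⟩
    have hmem : c' ∈ agree (Y, c) := fun j => by
      have := hc' (Fin.castAdd k j)
      rw [Fin.append_left] at this
      exact this.trans (hc₀ j)
    refine hz ⟨c', hmem⟩ fun i => ?_
    have := hc' (Fin.natAdd K i)
    rwa [Fin.append_right] at this

/-! ### Boosting -/

open Classical in
/-- Every member of the family is approximated, with respect to any weight, by a member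
determined by its trace on a sequence of bounded length. -/
theorem exists_weak_hypothesis (d : ℕ) {ε : ℝ} (hε : 0 < ε) : ∃ k : ℕ,
    ∀ {ι Ω : Type*} [Fintype Ω] [Nonempty Ω] (R : ι → Ω → Prop), ¬ ShattersSeq R d →
      ∀ (a : ι) (w : Ω → ℕ), (∀ ω, 0 < w ω) → ∃ (c : ι) (z : Fin k → Ω),
        (∀ c', (∀ i, R c' (z i) ↔ R c (z i)) → R c' = R c) ∧
        ((∑ ω, if R c ω ↔ R a ω then 0 else w ω : ℕ) : ℝ) ≤ ε * ((∑ ω, w ω : ℕ) : ℝ) := by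
  obtain ⟨m, hm0, hm⟩ := exists_approx d hε
  obtain ⟨k, hk⟩ := exists_teaching d
  refine ⟨m + k, fun {ι Ω} _ _ R hR a w hw => ?_⟩
  -- Repeating each point according to its weight makes the measure uniform.
  let X := Σ ω, Fin (w ω)
  have : Nonempty X := ⟨⟨Classical.arbitrary Ω, ⟨0, hw _⟩⟩⟩
  have hX : Fintype.card X = ∑ ω, w ω := by simp [X]
  obtain ⟨Q, hQ⟩ : ∃ Q : ι → X → Prop, Q = fun c x => (R c x.1 ↔ ¬ R a x.1) := ⟨_, rfl⟩
  obtain ⟨s, hs⟩ := hm Q fun h => hR ((ShattersSeq.comap (R := fun c ω => R c ω ↔ ¬ R a ω) id Sigma.fst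
    (hQ ▸ h)).symmDiff _)
  -- Every member agreeing with the target on the sample has small error. It remains to teach one of
  -- them within that subfamily; sample and teaching points together determine it in the whole
  -- family.
  have : Nonempty {c // ∀ i, R c (s i).1 ↔ R a (s i).1} := ⟨⟨a, fun i => Iff.rfl⟩⟩
  obtain ⟨⟨c, hc⟩, z, hz⟩ := hk
    (fun (c : {c // ∀ i, R c (s i).1 ↔ R a (s i).1}) ω => R c ω)
    fun h => hR (ShattersSeq.comap Subtype.val id h)
  refine ⟨c, Fin.append (fun i => (s i).1) z, fun c' hc' => ?_, ?_⟩
  · have hmem : ∀ i, R c' (s i).1 ↔ R a (s i).1 := fun i => by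
      have := hc' (Fin.castAdd k i)
      rw [Fin.append_left] at this
      exact this.trans (hc i)
    refine hz ⟨c', hmem⟩ fun i => ?_
    have := hc' (Fin.natAdd m i)
    rwa [Fin.append_right] at this
  · have h0 := hs c
    have h1 : (Finset.univ.filter fun i => Q c (s i)) = ∅ := by
      refine Finset.filter_eq_empty_iff.2 fun i _ => ?_
      have := hc i
      simp only [hQ]
      tauto
    have h2 : (Finset.univ.filter fun x : X => Q c x).card
        = ∑ ω, if R c ω ↔ R a ω then 0 else w ω := by
      rw [Finset.card_filter, Fintype.sum_sigma]
      refine Finset.sum_congr rfl fun ω _ => ?_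
      by_cases h : R c ω ↔ R a ω
      · have hq : ∀ y, ¬ Q c ⟨ω, y⟩ := fun y => by simp only [hQ]; tauto
        simp [h, hq]
      · have hq : ∀ y, Q c ⟨ω, y⟩ := fun y => by simp only [hQ]; tauto
        simp [h, hq]
    have hXpos : (0 : ℝ) < Fintype.card X := by exact_mod_cast Fintype.card_pos
    rw [h1, Finset.card_empty, Nat.cast_zero, zero_div, zero_sub, abs_neg,
      abs_of_nonneg (by positivity), div_le_iff₀ hXpos, h2, hX] at h0
    exact h0

open Classical in
/-- Boosting: `T` members, each determined by a sequence of bounded length, such that the total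
weight is small when the weight of a point is doubled for each member that is wrong there. -/
theorem exists_boosting (d : ℕ) : ∃ k : ℕ,
    ∀ {ι Ω : Type*} [Fintype Ω] [Nonempty Ω] (R : ι → Ω → Prop), ¬ ShattersSeq R d →
      ∀ (a : ι) (T : ℕ), ∃ (c : Fin T → ι) (z : Fin T → Fin k → Ω),
        (∀ t c', (∀ i, R c' (z t i) ↔ R (c t) (z t i)) → R c' = R (c t)) ∧
        ((∑ ω, 2 ^ (∑ t, if R (c t) ω ↔ R a ω then 0 else 1) : ℕ) : ℝ)
          ≤ (17 / 16) ^ T * Fintype.card Ω := by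
  obtain ⟨k, hk⟩ := exists_weak_hypothesis d (ε := 1 / 16) (by norm_num)
  refine ⟨k, fun {ι Ω} _ _ R hR a T => ?_⟩
  induction T with
  | zero => exact ⟨Fin.elim0, Fin.elim0, fun t => t.elim0, by simp⟩
  | succ T ih =>
    obtain ⟨c, z, hz, hW⟩ := ih
    obtain ⟨c₀, z₀, hz₀, hw⟩ := hk R hR a
      (fun ω => 2 ^ (∑ t, if R (c t) ω ↔ R a ω then 0 else 1)) (fun ω => by positivity)
    refine ⟨Fin.cons c₀ c, Fin.cons z₀ z, fun t => ?_, ?_⟩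
    · refine Fin.cases ?_ (fun t => ?_) t
      · simpa using hz₀
      · simpa using hz t
    · have h1 : ∀ ω, 2 ^ (∑ t : Fin (T + 1),
            if R ((Fin.cons c₀ c : Fin (T + 1) → ι) t) ω ↔ R a ω then 0 else 1)
          = 2 ^ (∑ t, if R (c t) ω ↔ R a ω then 0 else 1) +
            if R c₀ ω ↔ R a ω then 0 else 2 ^ (∑ t, if R (c t) ω ↔ R a ω then 0 else 1) := by
        intro ω
        rw [Fin.sum_univ_succ]
        simp only [Fin.cons_zero, Fin.cons_succ]
        split_ifs
        · simp
        · rw [pow_add]; ring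
      rw [Finset.sum_congr rfl fun ω _ => h1 ω, Finset.sum_add_distrib, Nat.cast_add, pow_succ]
      linarith

open Classical in
/-- Every member of the family is, on a finite set, the majority vote of boundedly many members
determined by their traces on sequences of bounded length. -/
theorem exists_majority (d : ℕ) : ∃ k m : ℕ,
    ∀ {ι Ω : Type*} [Fintype Ω] [Nonempty Ω] (R : ι → Ω → Prop), ¬ ShattersSeq R d →
      ∀ a : ι, ∃ (c : Fin m → ι) (z : Fin m → Fin k → Ω),
        (∀ t c', (∀ i, R c' (z t i) ↔ R (c t) (z t i)) → R c' = R (c t)) ∧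
        ∀ ω, R a ω ↔ m < 2 * (Finset.univ.filter fun t => R (c t) ω).card := by
  obtain ⟨k, hk⟩ := exists_boosting d
  -- The dual family shatters no `2 ^ d` members, so the number `m` of sampled votes does not depend
  -- on `Ω`.
  obtain ⟨m, hm0, hm⟩ := exists_approx (Fintype.card (Fin d → Prop)) (ε := 1 / 8) (by norm_num)
  refine ⟨k, m, fun {ι Ω} _ _ R hR a => ?_⟩
  set N := Fintype.card Ω with hN
  have hN0 : 0 < N := Fintype.card_pos
  obtain ⟨c, z, hz, hW⟩ := hk R hR a (8 * N)
  -- With `8 * N` rounds, `(17 / 16) ^ 8 ≤ 2` and `N ≤ 2 ^ N` leave at most a quarter of the votes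
  -- wrong at any point; a sampling error of `1 / 8` then preserves the majority.
  have hwrong : ∀ ω, ∑ t, (if R (c t) ω ↔ R a ω then 0 else 1) ≤ 2 * N := by
    intro ω
    set r := ∑ t, (if R (c t) ω ↔ R a ω then 0 else 1) with hr
    have h1 : (2 : ℝ) ^ r ≤ (17 / 16) ^ (8 * N) * N := by
      refine le_trans ?_ hW
      have := Finset.single_le_sum (f := fun ω => 2 ^ (∑ t, if R (c t) ω ↔ R a ω then 0 else 1))
        (fun _ _ => Nat.zero_le _) (Finset.mem_univ ω)
      exact_mod_cast this
    have h2 : ((17 : ℝ) / 16) ^ (8 * N) ≤ 2 ^ N := by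
      rw [pow_mul]
      gcongr
      norm_num
    have h3 : (N : ℝ) ≤ 2 ^ N := by exact_mod_cast (Nat.lt_two_pow_self (n := N)).le
    have h4 : (2 : ℝ) ^ r ≤ 2 ^ (2 * N) := by
      calc (2 : ℝ) ^ r ≤ (17 / 16) ^ (8 * N) * N := h1
        _ ≤ 2 ^ N * 2 ^ N := by gcongr
        _ = _ := by rw [two_mul, pow_add]
    exact (pow_le_pow_iff_right₀ (by norm_num : (1 : ℝ) < 2)).1 h4
  have : Nonempty (Fin (8 * N)) := ⟨⟨0, by omega⟩⟩
  obtain ⟨s, hs⟩ := hm (fun (ω : Ω) (t : Fin (8 * N)) => R (c t) ω) fun h =>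
    hR ((ShattersSeq.comap (R := fun ω c => R c ω) id c h).of_flip)
  refine ⟨c ∘ s, z ∘ s, fun t => hz (s t), fun ω => ?_⟩
  have h0 := abs_le.1 (hs ω)
  have hw := hwrong ω
  rw [Fintype.card_fin] at h0
  have hmR : (0 : ℝ) < m := by exact_mod_cast hm0
  have hNR : (0 : ℝ) < N := by exact_mod_cast hN0
  set A := (Finset.univ.filter fun i => R (c (s i)) ω).card with hA
  set F := (Finset.univ.filter fun t => R (c t) ω).card with hF
  have hgoal : (Finset.univ.filter fun t => R ((c ∘ s) t) ω).card = A := rfl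
  rw [hgoal]
  push_cast at h0
  by_cases ha : R a ω
  · have h1 : 6 * N ≤ F := by
      have h2 : F + ∑ t, (if R (c t) ω ↔ R a ω then 0 else 1) = 8 * N := by
        rw [hF, Finset.card_filter, ← Finset.sum_add_distrib]
        rw [Finset.sum_congr rfl (g := fun _ => 1)]
        · simp
        · intro t _
          by_cases h : R (c t) ω <;> simp [h, ha]
      omega
    have h1R : (6 : ℝ) * N ≤ F := by exact_mod_cast h1
    have h3 : (3 : ℝ) / 4 ≤ F / (8 * N) := by
      rw [le_div_iff₀ (by positivity)]; linarith
    have h4 : (1 : ℝ) / 2 < A / m := by linarith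
    rw [lt_div_iff₀ hmR] at h4
    simp only [ha, true_iff]
    have : (m : ℝ) < 2 * A := by linarith
    exact_mod_cast this
  · have h1 : F ≤ 2 * N := by
      refine le_trans (le_of_eq ?_) hw
      rw [hF, Finset.card_filter]
      refine Finset.sum_congr rfl fun t _ => ?_
      by_cases h : R (c t) ω <;> simp [h, ha]
    have h1R : (F : ℝ) ≤ 2 * N := by exact_mod_cast h1
    have h3 : (F : ℝ) / (8 * N) ≤ 1 / 4 := by
      rw [div_le_iff₀ (by positivity)]; linarith
    have h4 : (A : ℝ) / m < 1 / 2 := by linarith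
    rw [div_lt_iff₀ hmR] at h4
    simp only [ha, false_iff, not_lt]
    have : 2 * (A : ℝ) ≤ m := by linarith
    exact_mod_cast this

/-! ### The maximum class of sets with at most `d` elements -/

/-- Tracing on `F ⊆ A` gives the subsets of `F` with at most `d` elements, so `F` is shattered
exactly when it has at most `d` elements, and counting by size attains Sauer's bound. -/
theorem isMaximum_encard_le {α : Type*} {A : Set α} (hA : A.Infinite) (d : ℕ) :
    IsMaximum A {s | s ⊆ A ∧ s.encard ≤ d} d := by
  classical
  have htrace : ∀ F : Set α, F ⊆ A →
      trace {s | s ⊆ A ∧ s.encard ≤ d} F = {s | s ⊆ F ∧ s.encard ≤ d} := by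
    intro F hF
    ext s
    constructor
    · rintro ⟨c, ⟨_, hc⟩, rfl⟩
      exact ⟨Set.inter_subset_right, (Set.encard_le_encard Set.inter_subset_left).trans hc⟩
    · rintro ⟨hs, hd⟩
      exact ⟨s, ⟨hs.trans hF, hd⟩, (Set.inter_eq_left.2 hs).symm⟩
  have hsh : ∀ F : Set α, F ⊆ A →
      (Shatters {s | s ⊆ A ∧ s.encard ≤ d} F ↔ F.encard ≤ d) := by
    intro F hF
    rw [Shatters, htrace F hF]
    constructor
    · intro h
      have : F ∈ 𝒫 F := Set.mem_powerset le_rfl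
      rw [← h] at this
      exact this.2
    · intro h
      ext s
      exact ⟨fun hs => hs.1, fun hs => ⟨hs, (Set.encard_le_encard hs).trans h⟩⟩
  refine ⟨le_antisymm ?_ ?_, ?_⟩
  · exact iSup₂_le fun F hF => (hsh F hF.1).1 hF.2
  · obtain ⟨F, hF, hd⟩ := Set.exists_subset_encard_eq (s := A) (k := d) (by simp [hA.encard_eq])
    refine le_trans hd.ge (le_iSup₂ (f := fun (F : Set α) _ => F.encard) F ⟨hF, ?_⟩)
    exact (hsh F hF).2 hd.le
  · intro F hF
    rw [htrace _ hF]
    have h1 : {s : Set α | s ⊆ (F : Set α) ∧ s.encard ≤ d}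
        = (fun s : Finset α => (s : Set α)) '' (F.powerset.filter fun s => s.card ≤ d) := by
      ext s
      simp only [Set.mem_ofPred_eq, Finset.coe_filter, Finset.mem_powerset, Set.mem_image]
      constructor
      · rintro ⟨hs, hd⟩
        obtain ⟨s, rfl⟩ := (F.finite_toSet.subset hs).exists_finset_coe
        refine ⟨s, ⟨by exact_mod_cast hs, ?_⟩, rfl⟩
        rw [Set.encard_coe_eq_coe_finsetCard] at hd
        exact_mod_cast hd
      · rintro ⟨s, ⟨hs, hd⟩, rfl⟩
        refine ⟨by exact_mod_cast hs, ?_⟩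
        rw [Set.encard_coe_eq_coe_finsetCard]
        exact_mod_cast hd
    rw [h1, Set.ncard_image_of_injective _ Finset.coe_injective, Set.ncard_coe_finset, sauerBound]
    split_ifs with h
    · rw [Finset.card_eq_sum_card_fiberwise (f := Finset.card) (t := Finset.range (d + 1))]
      · refine Finset.sum_congr rfl fun i hi => ?_
        rw [← Finset.card_powersetCard, Finset.powersetCard_eq_filter, Finset.filter_filter]
        congr 1
        refine Finset.filter_congr fun s _ => ?_
        have := Finset.mem_range.1 hi
        omega
      · intro s hs
        have := (Finset.mem_filter.1 hs).2
        simpa [Nat.lt_succ_iff] using this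
    · rw [Finset.filter_true_of_mem, Finset.card_powerset]
      intro s hs
      have := Finset.card_le_card (Finset.mem_powerset.1 hs)
      omega

/-! ### Consequences of saturation -/

section Saturation

variable {L : Language} {M : Type*} [L.Structure M]

theorem holds_dual {m n : ℕ} (φ : L.Formula (Fin m ⊕ Fin n)) (a : Fin m → M) (b : Fin n → M) :
    Holds (dual φ) b a ↔ Holds φ a b := by
  rw [Holds, Holds, dual, Language.Formula.realize_relabel]
  have : Sum.elim b a ∘ Sum.swap = Sum.elim a b := by
    funext x
    cases x <;> rfl
  rw [this]

/-- Saturation, for formulas with countably many parameters plugged into free variables. -/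
theorem IsSaturated.exists_realize {κ : Cardinal} (hκ : Cardinal.aleph0 < κ)
    (hM : IsSaturated L M κ) {ι : Type*} [Countable ι] (p : ι → M) {n : ℕ} {J : Type*}
    (Θ : J → L.Formula (ι ⊕ Fin n))
    (h : ∀ F : Finset J, ∃ v : Fin n → M, ∀ j ∈ F, (Θ j).Realize (Sum.elim p v)) :
    ∃ v : Fin n → M, ∀ j, (Θ j).Realize (Sum.elim p v) := by
  classical
  let A : Set M := Set.range p
  let Θ' : J → L[[A]].Formula (Fin n) := fun j =>
    Language.BoundedFormula.constantsVarsEquiv.symm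
      ((Θ j).relabel (Sum.map (Set.rangeFactorization p) id))
  have hΘ : ∀ j v, (Θ' j).Realize v ↔ (Θ j).Realize (Sum.elim p v) := by
    intro j v
    rw [Language.Formula.Realize, ← Language.BoundedFormula.realize_constantsVarsEquiv,
      Equiv.apply_symm_apply, ← Language.Formula.Realize, Language.Formula.realize_relabel]
    have : Sum.elim (fun a => ((L.con a : L[[A]].Constants) : M)) v ∘
        Sum.map (Set.rangeFactorization p) id = Sum.elim p v := by
      funext x
      cases x <;> simp [Set.rangeFactorization]
    rw [this]
  obtain ⟨v, hv⟩ := hM A ((Cardinal.mk_le_aleph0_iff.2 (Set.countable_range p).to_subtype).trans_lt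
    hκ) n (Set.range Θ') (by
      intro q hq
      choose g hg using fun x : q => hq x.2
      obtain ⟨v, hv⟩ := h (Finset.univ.image g)
      refine ⟨v, fun θ hθ => ?_⟩
      have := (hΘ _ v).2 (hv (g ⟨θ, hθ⟩) (Finset.mem_image_of_mem _ (Finset.mem_univ _)))
      rwa [hg] at this)
  exact ⟨v, fun j => (hΘ j v).1 (hv _ ⟨j, rfl⟩)⟩

variable {m n : ℕ}

open Classical in
/-- The formula expressing that the tuples `b i`, `i : K`, are shattered by `φ`. -/
noncomputable def shatterFormula (φ : L.Formula (Fin m ⊕ Fin n)) (K : Type) [Finite K] :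
    L.Formula (K × Fin n) :=
  Language.Formula.iInf fun η : K → Prop => Language.Formula.iExs (Fin m) <|
    Language.Formula.iInf fun i : K =>
      let θ : L.Formula ((K × Fin n) ⊕ Fin m) :=
        φ.relabel (Sum.elim Sum.inr fun j => Sum.inl (i, j))
      if η i then θ else ∼θ

theorem realize_shatterFormula (φ : L.Formula (Fin m ⊕ Fin n)) (K : Type) [Finite K]
    (b : K → Fin n → M) : (shatterFormula φ K).Realize (fun q => b q.1 q.2) ↔
      ∀ η : K → Prop, ∃ a, ∀ i, Holds φ a (b i) ↔ η i := by
  rw [shatterFormula, Language.Formula.realize_iInf]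
  refine forall_congr' fun η => ?_
  rw [Language.Formula.realize_iExs]
  refine exists_congr fun a => ?_
  rw [Language.Formula.realize_iInf]
  refine forall_congr' fun i => ?_
  have : Sum.elim (fun q : K × Fin n => b q.1 q.2) a ∘
      (Sum.elim Sum.inr fun j => Sum.inl (i, j)) = Sum.elim a (b i) := by
    funext x
    cases x <;> rfl
  by_cases h : η i
  · simp [h, Language.Formula.realize_relabel, this, Holds]
  · simp [h, Language.Formula.realize_relabel, Language.Formula.realize_not, this, Holds]

/-- The tuples `b i` can be extended to shattered families by arbitrarily many tuples. -/
def Extendable (φ : L.Formula (Fin m ⊕ Fin n)) {K : Type} (b : K → Fin n → M) : Prop :=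
  ∀ N : ℕ, ∃ c : Fin N → Fin n → M, ∀ η : K ⊕ Fin N → Prop,
    ∃ a, ∀ i, Holds φ a (Sum.elim b c i) ↔ η i

/-- Finitely many extension lengths are handled by one long shattered extension: its last tuple is
the new one and initial segments of the rest extend it. Saturation then handles all lengths at once.
-/
theorem Extendable.exists_option {κ : Cardinal} (hκ : Cardinal.aleph0 < κ)
    (hM : IsSaturated L M κ) {φ : L.Formula (Fin m ⊕ Fin n)} {K : Type} [Finite K]
    {b : K → Fin n → M} (hb : Extendable φ b) :
    ∃ y : Fin n → M, Extendable φ (fun o : Option K => o.elim y b) := by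
  let e : ∀ N, (Option K ⊕ Fin N) × Fin n → ((K × Fin n) ⊕ Fin n) ⊕ (Fin N × Fin n) := fun N q =>
    match q with
    | (Sum.inl none, j) => Sum.inl (Sum.inr j)
    | (Sum.inl (some i), j) => Sum.inl (Sum.inl (i, j))
    | (Sum.inr i, j) => Sum.inr (i, j)
  let Θ : ℕ → L.Formula ((K × Fin n) ⊕ Fin n) := fun N =>
    Language.Formula.iExs (Fin N × Fin n) ((shatterFormula φ (Option K ⊕ Fin N)).relabel (e N))
  have hΘ : ∀ N (y : Fin n → M), (Θ N).Realize (Sum.elim (fun q => b q.1 q.2) y) ↔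
      ∃ c : Fin N → Fin n → M, ∀ η : Option K ⊕ Fin N → Prop,
        ∃ a, ∀ i, Holds φ a (Sum.elim (fun o : Option K => o.elim y b) c i) ↔ η i := by
    intro N y
    rw [Language.Formula.realize_iExs]
    have hcomp : ∀ c : Fin N → Fin n → M,
        Sum.elim (Sum.elim (fun q : K × Fin n => b q.1 q.2) y) (fun q => c q.1 q.2) ∘ e N
        = fun q => Sum.elim (fun o : Option K => o.elim y b) c q.1 q.2 := by
      intro c
      funext q
      rcases q with ⟨((_ | i) | i), j⟩ <;> rfl
    constructor
    · rintro ⟨c, hc⟩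
      rw [Language.Formula.realize_relabel] at hc
      have := hcomp (fun i j => c (i, j))
      simp only [Prod.mk.eta] at this
      rw [this, realize_shatterFormula] at hc
      exact ⟨_, hc⟩
    · rintro ⟨c, hc⟩
      refine ⟨fun q => c q.1 q.2, ?_⟩
      rw [Language.Formula.realize_relabel, hcomp, realize_shatterFormula]
      exact hc
  obtain ⟨y, hy⟩ := hM.exists_realize hκ (fun q : K × Fin n => b q.1 q.2) Θ (by
    intro F
    obtain ⟨c, hc⟩ := hb (F.sup id + 1)
    refine ⟨c (Fin.last _), fun N hN => ?_⟩
    have hNF : N ≤ F.sup id := Finset.le_sup (f := id) hN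
    rw [hΘ]
    refine ⟨fun i => c (Fin.castLE (by omega) i), fun η => ?_⟩
    -- Positions from `N` on receive the value wanted at the new tuple; among these only the last
    -- matters.
    obtain ⟨a, ha⟩ := hc (Sum.elim (fun i => η (Sum.inl (some i)))
      (fun i => if h : (i : ℕ) < N then η (Sum.inr ⟨i, h⟩) else η (Sum.inl none)))
    refine ⟨a, ?_⟩
    rintro ((_ | i) | i)
    · have := ha (Sum.inr (Fin.last _))
      simpa [not_lt.2 hNF] using this
    · exact ha (Sum.inl i)
    · have := ha (Sum.inr (Fin.castLE (by omega) i))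
      simpa using this)
  exact ⟨y, fun N => (hΘ N y).1 (hy N)⟩

theorem exists_shattered_sequence {κ : Cardinal} (hκ : Cardinal.aleph0 < κ)
    (hM : IsSaturated L M κ) {φ : L.Formula (Fin m ⊕ Fin n)}
    (hφ : ∀ d, ShattersSeq (fun (a : Fin m → M) b => Holds φ a b) d) :
    ∃ b : ℕ → Fin n → M, ∀ S : Set ℕ, ∃ a, ∀ i, Holds φ a (b i) ↔ i ∈ S := by
  classical
  have hstep : ∀ (k : ℕ) (b : ℕ → Fin n → M), Extendable φ (fun i : Fin k => b i) →
      ∃ y, Extendable φ (fun i : Fin (k + 1) => Function.update b k y i) := by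
    intro k b hb
    obtain ⟨y, hy⟩ := hb.exists_option hκ hM
    refine ⟨y, fun N => ?_⟩
    obtain ⟨c, hc⟩ := hy N
    refine ⟨c, fun η => ?_⟩
    obtain ⟨a, ha⟩ := hc (Sum.elim (fun o => η (Sum.inl (o.elim (Fin.last k) Fin.castSucc)))
      (fun i => η (Sum.inr i)))
    refine ⟨a, ?_⟩
    rintro (i | i)
    · refine Fin.lastCases ?_ (fun i => ?_) i
      · simpa using ha (Sum.inl none)
      · have := ha (Sum.inl (some i))
        simpa [Function.update_of_ne i.2.ne] using this
    · exact ha (Sum.inr i)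
  have h0 : Extendable φ (fun i : Fin 0 => (i.elim0 : Fin n → M)) := by
    intro N
    obtain ⟨c, hc⟩ := hφ N
    refine ⟨c, fun η => ?_⟩
    obtain ⟨a, ha⟩ := hc (fun i => η (Sum.inr i))
    exact ⟨a, by rintro (i | i); exacts [i.elim0, ha i]⟩
  -- A default tuple for the entries not yet constructed.
  obtain ⟨x₀, -⟩ := hφ 1
  let f : ∀ k : ℕ, {b : ℕ → Fin n → M // Extendable φ (fun i : Fin k => b i)} := fun k =>
    Nat.rec ⟨fun _ => x₀ 0, by convert h0⟩
      (fun k b => ⟨Function.update b.1 k (hstep k b.1 b.2).choose, (hstep k b.1 b.2).choose_spec⟩) k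
  have hf : ∀ k i, i ≠ k → (f (k + 1)).1 i = (f k).1 i := fun k i hi =>
    Function.update_of_ne hi _ _
  have hf' : ∀ k i, i < k → (f k).1 i = (f (i + 1)).1 i := by
    intro k
    induction k with
    | zero => intro i hi; omega
    | succ k ih =>
      intro i hi
      rcases Nat.lt_succ_iff_lt_or_eq.1 hi with h | rfl
      · rw [hf k i h.ne, ih i h]
      · rfl
  let b : ℕ → Fin n → M := fun i => (f (i + 1)).1 i
  refine ⟨b, fun S => ?_⟩
  let Θ : ℕ → L.Formula ((ℕ × Fin n) ⊕ Fin m) := fun i =>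
    let θ : L.Formula ((ℕ × Fin n) ⊕ Fin m) := φ.relabel (Sum.elim Sum.inr fun j => Sum.inl (i, j))
    if i ∈ S then θ else ∼θ
  have hΘ : ∀ i (a : Fin m → M), (Θ i).Realize (Sum.elim (fun q => b q.1 q.2) a) ↔
      (Holds φ a (b i) ↔ i ∈ S) := by
    intro i a
    have : Sum.elim (fun q : ℕ × Fin n => b q.1 q.2) a ∘
        (Sum.elim Sum.inr fun j => Sum.inl (i, j)) = Sum.elim a (b i) := by
      funext x
      cases x <;> rfl
    by_cases h : i ∈ S
    · simp [Θ, h, Language.Formula.realize_relabel, this, Holds]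
    · simp [Θ, h, Language.Formula.realize_relabel, Language.Formula.realize_not, this, Holds]
  -- A second use of saturation, now over the countably many entries of `b`: finite shattering makes
  -- the prescribed trace finitely satisfiable.
  obtain ⟨a, ha⟩ := hM.exists_realize hκ (fun q : ℕ × Fin n => b q.1 q.2) Θ (by
    intro F
    obtain ⟨c, hc⟩ := (f (F.sup id + 1)).2 0
    obtain ⟨a, ha⟩ := hc (Sum.elim (fun i => (i : ℕ) ∈ S) fun i => i.elim0)
    refine ⟨a, fun i hi => (hΘ i a).2 ?_⟩
    have hlt : i < F.sup id + 1 := Nat.lt_succ_of_le (Finset.le_sup (f := id) hi)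
    have := ha (Sum.inl ⟨i, hlt⟩)
    simp only [Sum.elim_inl] at this
    rwa [hf' _ i hlt] at this)
  exact ⟨a, fun i => (hΘ i a).1 (ha i)⟩

/-- If for some `d` the dual formula has no infinite `d`-maximum family, then `φ` is dependent. -/
theorem exists_not_shattersSeq {κ : Cardinal} (hκ : Cardinal.aleph0 < κ)
    (hM : IsSaturated L M κ) {φ : L.Formula (Fin m ⊕ Fin n)} {d : ℕ}
    (hφ : d ∉ maximumDims M (dual φ)) :
    ∃ N, ¬ ShattersSeq (fun (a : Fin m → M) b => Holds φ a b) N := by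
  by_contra hcon
  push Not at hcon
  obtain ⟨b, hb⟩ := exists_shattered_sequence hκ hM hcon
  have hinj : Function.Injective b := by
    intro i j hij
    obtain ⟨a, ha⟩ := hb {i}
    have h := (ha i).2 rfl
    rw [hij] at h
    exact ((ha j).1 h).symm
  have hA : (Set.range b).Infinite := Set.infinite_range_of_injective hinj
  -- Restricting to the tuples that cut out at most `d` points leaves exactly the subsets of size at
  -- most `d`.
  refine hφ ⟨Set.range b, {a | {x | x ∈ Set.range b ∧ Holds φ a x}.encard ≤ d}, hA, ?_⟩
  convert isMaximum_encard_le hA d using 1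
  ext s
  constructor
  · rintro ⟨a, ha, rfl⟩
    simp only [holds_dual]
    exact ⟨fun x hx => hx.1, ha⟩
  · rintro ⟨hs, hd⟩
    obtain ⟨a, ha⟩ := hb (b ⁻¹' s)
    have : s = {x | x ∈ Set.range b ∧ Holds φ a x} := by
      ext x
      constructor
      · intro hx
        obtain ⟨i, rfl⟩ := hs hx
        exact ⟨⟨i, rfl⟩, (ha i).2 hx⟩
      · rintro ⟨⟨i, rfl⟩, hx⟩
        exact (ha i).1 hx
    refine ⟨a, ?_, ?_⟩
    · simp only [Set.mem_ofPred_eq]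
      rwa [← this]
    · simp only [holds_dual]
      exact this

theorem notMem_maximumDims_of_maxDim_lt {φ : L.Formula (Fin m ⊕ Fin n)} {d : ℕ}
    (h : maxDim M φ < d) : d ∉ maximumDims M φ := by
  intro hd
  rw [maxDim] at h
  split_ifs at h with hg
  · exact absurd (hg.choose_spec.2 hd) (not_le.2 (by exact_mod_cast h))
  · exact not_top_lt h

end Saturation
/-! ### Definability of types from majority votes -/

section Voting

variable {L : Language} {M : Type*} [L.Structure M] {m n : ℕ}

/-- The formula expressing the equality of two tuples of variables. -/
noncomputable def tupleEq {V : Type} (u v : Fin n → V) : L.Formula V :=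
  Language.Formula.iInf fun j => ((Language.var (u j) : L.Term V).equal (Language.var (v j)))

theorem realize_tupleEq {V : Type} (u v : Fin n → V) (r : V → M) :
    (tupleEq (L := L) u v).Realize r ↔ r ∘ u = r ∘ v := by
  rw [tupleEq, Language.Formula.realize_iInf, funext_iff]
  refine forall_congr' fun j => ?_
  rw [Language.Formula.realize_equal]
  rfl

/-- The parameters of `q` votes, each a list of `k` tuples, with a pair of tuples
coding a truth value for each. -/
abbrev VoteParam (q k : ℕ) : Type := Fin q × Fin k × Fin 3

/-- The variables of the voting formula. -/
abbrev VoteVar (n q k : ℕ) : Type := Fin n ⊕ (VoteParam q k × Fin n)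

/-- The formula `∃ x, (⋀ i, φ(x; zᵢ) ↔ uᵢ = vᵢ) ∧ φ(x; y)`. -/
noncomputable def voteFormula (φ : L.Formula (Fin m ⊕ Fin n)) {q : ℕ} (k : ℕ) (t : Fin q) :
    L.Formula (VoteVar n q k) :=
  Language.Formula.iExs (Fin m) <|
    (Language.Formula.iInf fun i : Fin k =>
      (φ.relabel (Sum.elim Sum.inr fun j => Sum.inl (Sum.inr ((t, i, 0), j))) :
        L.Formula (VoteVar n q k ⊕ Fin m)).iff
      (tupleEq (fun j => Sum.inl (Sum.inr ((t, i, 1), j)))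
        (fun j => Sum.inl (Sum.inr ((t, i, 2), j))))) ⊓
    φ.relabel (Sum.elim Sum.inr fun j => Sum.inl (Sum.inl j))

theorem realize_voteFormula (φ : L.Formula (Fin m ⊕ Fin n)) {q k : ℕ} (t : Fin q)
    (y : Fin n → M) (p : VoteParam q k → Fin n → M) :
    (voteFormula φ k t).Realize (Sum.elim y fun s => p s.1 s.2) ↔
      ∃ x, (∀ i, Holds φ x (p (t, i, 0)) ↔ p (t, i, 1) = p (t, i, 2)) ∧ Holds φ x y := by
  rw [voteFormula, Language.Formula.realize_iExs]
  refine exists_congr fun x => ?_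
  rw [Language.Formula.realize_inf, Language.Formula.realize_iInf,
    Language.Formula.realize_relabel]
  refine and_congr (forall_congr' fun i => ?_) ?_
  · rw [Language.Formula.realize_iff, realize_tupleEq, Language.Formula.realize_relabel]
    refine iff_congr (iff_of_eq ?_) Iff.rfl
    rw [Holds]
    congr 1
    funext s
    cases s <;> rfl
  · refine iff_of_eq ?_
    rw [Holds]
    congr 1
    funext s
    cases s <;> rfl

/-- The majority vote of the formulas `voteFormula φ k t`. -/
noncomputable def majorityFormula (φ : L.Formula (Fin m ⊕ Fin n)) (q k : ℕ) :
    L.Formula (VoteVar n q k) :=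
  Language.Formula.iSup fun S : {S : Finset (Fin q) // q < 2 * S.card} =>
    Language.Formula.iInf fun t : S.1 => voteFormula φ k (t : Fin q)

open Classical in
theorem realize_majorityFormula (φ : L.Formula (Fin m ⊕ Fin n)) {q k : ℕ}
    (r : VoteVar n q k → M) : (majorityFormula φ q k).Realize r ↔
      q < 2 * (Finset.univ.filter fun t => (voteFormula φ k t).Realize r).card := by
  rw [majorityFormula, Language.Formula.realize_iSup]
  simp only [Language.Formula.realize_iInf]
  constructor
  · rintro ⟨⟨S, hS⟩, h⟩
    refine hS.trans_le (Nat.mul_le_mul_left 2 (Finset.card_le_card fun t ht => ?_))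
    exact Finset.mem_filter.2 ⟨Finset.mem_univ _, h ⟨t, ht⟩⟩
  · intro h
    exact ⟨⟨_, h⟩, fun t => (Finset.mem_filter.1 t.2).2⟩

/-- Dependent formulas have uniform definability of types over finite sets. -/
theorem hasUDTFS_of_not_shattersSeq {φ : L.Formula (Fin m ⊕ Fin n)} {d : ℕ}
    (hφ : ¬ ShattersSeq (fun (a : Fin m → M) b => Holds φ a b) d) : HasUDTFS M φ := by
  classical
  obtain ⟨k, q, hkq⟩ := exists_majority d
  let e := Fintype.equivFin (VoteParam q k)
  refine ⟨_, (majorityFormula φ q k).relabel (Sum.map id (Prod.map e id)), ?_⟩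
  intro B hB a
  obtain ⟨u, hu, v, hv, huv⟩ := Finset.one_lt_card.1 hB
  have : Nonempty B := ⟨⟨u, hu⟩⟩
  obtain ⟨c, z, hz, hmaj⟩ := hkq (fun (a : Fin m → M) (b : B) => Holds φ a b)
    (fun h => hφ (ShattersSeq.comap id Subtype.val h)) a
  -- Slot 0 carries a teaching point; slots 1 and 2 are equal exactly when the vote is true there.
  -- Coding falsehood needs the two distinct elements `u`, `v` of `B`.
  let p : VoteParam q k → Fin n → M := fun s =>
    if s.2.2 = 0 then z s.1 s.2.1 else if s.2.2 = 1 then u else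
      if Holds φ (c s.1) (z s.1 s.2.1) then u else v
  have hp : ∀ s, p s ∈ B := by
    intro s
    simp only [p]
    split_ifs
    exacts [(z _ _).2, hu, hu, hv]
  refine ⟨p ∘ e.symm, fun i => hp _, fun b hb => ?_⟩
  have hcomp : Sum.elim b (fun s : Fin (Fintype.card (VoteParam q k)) × Fin n =>
      (p ∘ e.symm) s.1 s.2) ∘ Sum.map id (Prod.map e id) = Sum.elim b fun s => p s.1 s.2 := by
    funext s
    rcases s with s | ⟨s, j⟩ <;> simp
  rw [Language.Formula.realize_relabel, hcomp, realize_majorityFormula, hmaj ⟨b, hb⟩]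
  have hvote : ∀ t, (voteFormula φ k t).Realize (Sum.elim b fun s => p s.1 s.2) ↔
      Holds φ (c t) b := by
    intro t
    rw [realize_voteFormula]
    have hlab : ∀ i, p (t, i, 1) = p (t, i, 2) ↔ Holds φ (c t) (z t i) := by
      intro i
      by_cases h : Holds φ (c t) (z t i) <;> simp [p, h, huv]
    have hpz : ∀ i, p (t, i, 0) = z t i := fun i => by simp [p]
    simp only [hlab, hpz]
    constructor
    · rintro ⟨x, hx, hxb⟩
      -- The witness `x` need not be `c t`, but the teaching property makes them agree on all of
      -- `B`.
      have := congrFun (hz t x hx) ⟨b, hb⟩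
      simp only [eq_iff_iff] at this
      exact this.1 hxb
    · exact fun h => ⟨c t, fun i => Iff.rfl, h⟩
  simp only [hvote]

end Voting
end MaxFormula

theorem mainTheorem3 {L : FirstOrder.Language} {M : Type*} [L.Structure M]
    (κ : Cardinal) (hκ : Cardinal.aleph0 < κ) (hM : MaxFormula.IsSaturated L M κ)
    {m n : ℕ} (φ : L.Formula (Fin m ⊕ Fin n))
    (hφ : MaxFormula.maxDim M (MaxFormula.dual φ) = 1) :
    MaxFormula.HasUDTFS M φ := by
  obtain ⟨N, hN⟩ := MaxFormula.exists_not_shattersSeq hκ hM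
    (MaxFormula.notMem_maximumDims_of_maxDim_lt (d := 2) (by rw [hφ]; norm_num))
  exact MaxFormula.hasUDTFS_of_not_shattersSeq hN
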